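/- Let $N\ge 1$, let $\Omega\subset\mathbb R^N$ be compact and convex, let $f^+,f^-$ be finite positive Borel measures on $\Omega$ of equal total mass, and let $f=f^+-f^-$. Let $C^1_0(\mathbb R^N)$ be the space of $C^1$ functions on $\mathbb R^N$ that vanish at infinity together with their first derivatives. For $\varphi\in C^1_0(\mathbb R^N)$ and $(x,v,t)\in\Omega\times S^{N-1}\times[0,\infty)$ put $$D_\varphi(x,v,t)=\frac{\varphi(x+tv)-\varphi(x)}{t}\ \text{ if } t\ne 0,\qquad D_\varphi(x,v,0)=D\varphi(x)\cdot v .$$ A finite positive Borel measure $\sigma$ on $\Omega\times S^{N-1}\times[0,\infty)$ is called admissible if $$\int D_\varphi\,d\sigma=\int_\Omega\varphi\,df\qquad\text{for all }\varphi\in C^1_0(\mathbb R^N),$$ and optimal if moreover its total variation $\|\sigma\|$ is least among all admissible measures. Fix $e_1\in S^{N-1}$ and define $p:\Omega\times\Omega\to\Omega\times S^{N-1}\times[0,\infty)$ by $$p(x,y)=\Big(y,\frac{x-y}{|x-y|},|x-y|\Big)\ \text{ if } x\ne y,\qquad p(x,x)=(x,e_1,0).$$ A transport plan is a positive Borel measure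 $\gamma$ on $\Omega\times\Omega$ with marginals $\pi^1_\sharp\gamma=f^+$ and $\pi^2_\sharp\gamma=f^-$; it is optimal if it minimizes $\int|x-y|\,d\gamma$ among all transport plans. Then: 1. for every transport plan $\gamma$, the measure $p_\sharp(|x-y|\gamma)$ is admissible; 2. for every optimal transport plan $\gamma$, the measure $p_\sharp(|x-y|\gamma)$ is optimal; 3. an optimal $\sigma$ exists, and $$\mathcal W^1(f)=\min\{\|\sigma\| : \sigma \text{ admissible}\},$$ where $\mathcal W^1(f)$ may be taken as any of the following three quantities, each of which equals the minimum: $$\sup\Big\{\int_\Omega u\,df : u\in C^1_0(\mathbb R^N),\ \|\nabla u\|_\infty\le 1\Big\},\qquad \inf_{\pi^1_\sharp\gamma-\pi^2_\sharp\gamma=f}\int|x-y|\,d\gamma,\qquad \inf_{\pi^1_\sharp\gamma=f^+,\ \pi^2_\sharp\gamma=f^-}\int|x-y|\,d\gamma$$ (the infima are over finite positive Borel measures $\gamma$ on $\Omega\times\Omega$). -/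

import Mathlib

open Set Filter Topology MeasureTheory
open scoped ENNReal NNReal

noncomputable section

namespace TransportComparison

/-- The Euclidean space `ℝ^N`. -/
abbrev E (N : ℕ) : Type := EuclideanSpace ℝ (Fin N)

/-- The unit sphere `S^{N-1}` of `ℝ^N`. -/
abbrev S (N : ℕ) : Type := Metric.sphere (0 : E N) 1

/-- The product `Ω × S^{N-1} × [0,∞)`. -/
abbrev Phase {N : ℕ} (Ω : Set (E N)) : Type := Ω × S N × ℝ≥0

/-- The class `C^1_0(ℝ^N)`: functions of class `C^1` which vanish at infinity together with
their first derivatives. -/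
structure IsC10 {N : ℕ} (φ : E N → ℝ) : Prop where
  contDiff : ContDiff ℝ 1 φ
  tendsto_zero : Tendsto φ (cocompact (E N)) (𝓝 0)
  tendsto_fderiv_zero : Tendsto (fderiv ℝ φ) (cocompact (E N)) (𝓝 0)

/-- The duality pairing `⟨f, φ⟩ = ∫_Ω φ df` of a finite signed measure `f` on `Ω` with a function
`φ` on `ℝ^N`. -/
def pairing {N : ℕ} {Ω : Set (E N)} (f : SignedMeasure Ω) (φ : E N → ℝ) : ℝ :=
  ∫ᵛ x : Ω, φ x ∂<•f

/-- The difference quotient `D_φ(x,v,t)`, extended by the directional derivative at `t = 0`. -/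
def diffQuot {N : ℕ} {Ω : Set (E N)} (φ : E N → ℝ) (q : Phase Ω) : ℝ :=
  if q.2.2 = 0 then fderiv ℝ φ (q.1 : E N) (q.2.1 : E N)
  else (φ ((q.1 : E N) + (q.2.2 : ℝ) • (q.2.1 : E N)) - φ (q.1 : E N)) / (q.2.2 : ℝ)

/-- `σ` is a competitor of the minimum problem: a finite positive measure on
`Ω × S^{N-1} × [0,∞)` with `∫ D_φ dσ = ⟨f, φ⟩` for all `φ ∈ C^1_0(ℝ^N)`. -/
structure IsAdmissible {N : ℕ} {Ω : Set (E N)} (f : SignedMeasure Ω)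
    (σ : Measure (Phase Ω)) : Prop where
  finite : IsFiniteMeasure σ
  integral_eq : ∀ φ : E N → ℝ, IsC10 φ → ∫ q, diffQuot φ q ∂σ = pairing f φ

/-- The infimum of the total variations `‖σ‖ = σ(Ω × S^{N-1} × [0,∞))` over all competitors. -/
def dualMinValue {N : ℕ} {Ω : Set (E N)} (f : SignedMeasure Ω) : ℝ≥0∞ :=
  ⨅ (σ : Measure (Phase Ω)) (_ : IsAdmissible f σ), σ univ

/-- `σ` is a competitor of least total variation. -/
structure IsOptimal {N : ℕ} {Ω : Set (E N)} (f : SignedMeasure Ω)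
    (σ : Measure (Phase Ω)) : Prop where
  admissible : IsAdmissible f σ
  le : ∀ σ' : Measure (Phase Ω), IsAdmissible f σ' → σ univ ≤ σ' univ

/-- `γ` is a transport plan from `fp` to `fm`. -/
structure IsTransportPlan {N : ℕ} {Ω : Set (E N)} (fp fm : Measure Ω)
    (γ : Measure (Ω × Ω)) : Prop where
  map_fst : γ.map Prod.fst = fp
  map_snd : γ.map Prod.snd = fm

/-- The transportation cost `∫ |x - y| dγ(x,y)`. -/
def cost {N : ℕ} {Ω : Set (E N)} (γ : Measure (Ω × Ω)) : ℝ≥0∞ :=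
  ∫⁻ z, edist z.1 z.2 ∂γ

/-- `γ` is an optimal transport plan from `fp` to `fm`. -/
structure IsOptimalPlan {N : ℕ} {Ω : Set (E N)} (fp fm : Measure Ω)
    (γ : Measure (Ω × Ω)) : Prop where
  plan : IsTransportPlan fp fm γ
  le : ∀ γ' : Measure (Ω × Ω), IsTransportPlan fp fm γ' → cost γ ≤ cost γ'

/-- The Wasserstein distance: the infimum of the cost over all transport plans. -/
def wassersteinDist {N : ℕ} {Ω : Set (E N)} (fp fm : Measure Ω) : ℝ≥0∞ :=
  ⨅ (γ : Measure (Ω × Ω)) (_ : IsTransportPlan fp fm γ), cost γ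

/-- The Kantorovich norm: the infimum of the cost over all finite positive `γ` for which only the
difference of the two marginals is prescribed. -/
def kantorovichNorm {N : ℕ} {Ω : Set (E N)} (f : SignedMeasure Ω) : ℝ≥0∞ :=
  ⨅ (γ : Measure (Ω × Ω)) (_ : IsFiniteMeasure γ)
    (_ : (γ.map Prod.fst).toSignedMeasure - (γ.map Prod.snd).toSignedMeasure = f), cost γ

/-- The Wasserstein norm `W^1(f) = sup {⟨f, u⟩ : u ∈ C^1_0(ℝ^N), ‖∇u‖_∞ ≤ 1}`. As `u` and `-u`
compete together, cutting off negative values of the pairing does not change the supremum. -/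
def wassersteinNorm {N : ℕ} {Ω : Set (E N)} (f : SignedMeasure Ω) : ℝ≥0∞ :=
  ⨆ (u : E N → ℝ) (_ : IsC10 u) (_ : ∀ x, ‖fderiv ℝ u x‖ ≤ 1), ENNReal.ofReal (pairing f u)

/-- The unit vector `(x - y) / |x - y|` for `x ≠ y`. -/
def direction {N : ℕ} (x y : E N) (h : x ≠ y) : S N :=
  ⟨‖x - y‖⁻¹ • (x - y), by
    rw [mem_sphere_zero_iff_norm, norm_smul, norm_inv, norm_norm]
    exact inv_mul_cancel₀ (norm_ne_zero_iff.mpr (sub_ne_zero.mpr h))⟩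

open Classical in
/-- The map `p : Ω × Ω → Ω × S^{N-1} × [0,∞)` with `p(x,y) = (y, (x - y)/|x - y|, |x - y|)` off the
diagonal and `p(x,x) = (x, e₁, 0)`. For `x ≠ y` it satisfies
`|x - y| D_φ(p(x,y)) = φ(x) - φ(y)`. -/
def pMap {N : ℕ} {Ω : Set (E N)} (e₁ : S N) (z : Ω × Ω) : Phase Ω :=
  if h : (z.1 : E N) = z.2 then (z.1, e₁, 0)
  else (z.2, direction (z.1 : E N) (z.2 : E N) h, nndist z.1 z.2)

/-- The measure `p_♯(|x - y| γ)`. -/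
def liftPlan {N : ℕ} {Ω : Set (E N)} (e₁ : S N) (γ : Measure (Ω × Ω)) : Measure (Phase Ω) :=
  (γ.withDensity fun z => edist z.1 z.2).map (pMap e₁)

end TransportComparison

end

namespace TransportComparison

/-! All the values are caught in one cycle: `wassersteinNorm` ≤ `dualMinValue` ≤ `kantorovichNorm` ≤
`wassersteinDist` ≤ `wassersteinNorm`. The first inequality tests admissibility against `u` with
`‖∇u‖ ≤ 1`, for which `|D_u| ≤ 1` (`abs_diffQuot_le_one`). The second uses `|x - y| D_φ(p(x,y)) =
φ(x) - φ(y)` (`dist_mul_diffQuot_pMap`): lifting `γ` gives an admissible measure whose mass is the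
cost of `γ`. The third holds because fixing both marginals fixes their difference.

The last is Kantorovich–Rubinstein duality. Hahn–Banach, applied to the sublinear value function of
the dual problem, and the Riesz theorem produce a plan `γ₀`; nearly optimal dual potentials give
`1`-Lipschitz functions, which truncation and mollification bring into `C^1_0`. Since `γ₀` attains
the common value, its lift is optimal. -/

/-! ### Hahn–Banach and Riesz representation -/

theorem exists_linearMap_le_sublinear_eq {V : Type*} [AddCommGroup V] [Module ℝ V] (p : V → ℝ)
    (p_smul : ∀ c : ℝ, 0 < c → ∀ x, p (c • x) = c * p x)
    (p_add : ∀ x y, p (x + y) ≤ p x + p y) (x₀ : V) :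
    ∃ g : V →ₗ[ℝ] ℝ, g x₀ = p x₀ ∧ ∀ x, g x ≤ p x := by
  have p_zero : p 0 = 0 := by grind [p_smul 2 (by norm_num) 0, smul_zero]
  have hx₀ : ∀ c : ℝ, c • x₀ = 0 → c • p x₀ = 0 := by
    intro c hc
    rcases smul_eq_zero.mp hc with h | h
    · simp [h]
    · simp [h, p_zero]
  obtain ⟨g, hg, hle⟩ := exists_extension_of_le_sublinear
    (LinearPMap.mkSpanSingleton' x₀ (p x₀) hx₀) p p_smul p_add (by
      rintro ⟨x, hx⟩
      obtain ⟨c, rfl⟩ := Submodule.mem_span_singleton.mp hx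
      rw [LinearPMap.mkSpanSingleton'_apply, smul_eq_mul]
      rcases lt_trichotomy c 0 with hc | rfl | hc
      -- For negative `c`, subadditivity gives `0 = p 0 ≤ p (c • x₀) + (-c) * p x₀`.
      · have h₁ := p_add (c • x₀) ((-c) • x₀)
        rw [p_smul (-c) (by linarith), ← add_smul, add_neg_cancel, zero_smul, p_zero] at h₁
        change c * p x₀ ≤ p (c • x₀)
        linarith
      · simp [p_zero]
      · exact (p_smul c hc x₀).ge)
  refine ⟨g, ?_, hle⟩
  have := hg ⟨x₀, Submodule.mem_span_singleton_self x₀⟩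
  simpa using this.trans (LinearPMap.mkSpanSingleton'_apply_self x₀ (p x₀) hx₀ _)

/-- A positive linear functional on the continuous functions on a compact space is the integral
against a finite measure. -/
theorem exists_isFiniteMeasure_integral_eq {Y : Type*} [TopologicalSpace Y] [T2Space Y]
    [CompactSpace Y] [MeasurableSpace Y] [BorelSpace Y] (Λ : C(Y, ℝ) →ₗ[ℝ] ℝ)
    (hΛ : ∀ h : C(Y, ℝ), 0 ≤ h → 0 ≤ Λ h) :
    ∃ γ : Measure Y, IsFiniteMeasure γ ∧ ∀ h : C(Y, ℝ), ∫ z, h z ∂γ = Λ h := by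
  let T : CompactlySupportedContinuousMap Y ℝ →ₗ[ℝ] ℝ :=
    { toFun := fun h => Λ h.toContinuousMap
      map_add' := fun a b => Λ.map_add a.toContinuousMap b.toContinuousMap
      map_smul' := fun c a => Λ.map_smul c a.toContinuousMap }
  let P := PositiveLinearMap.mk₀ T fun h hh => hΛ h.toContinuousMap hh
  refine ⟨RealRMK.rieszMeasure P, inferInstance, fun h => ?_⟩
  exact RealRMK.integral_rieszMeasure P (CompactlySupportedContinuousMap.continuousMapEquiv h)

theorem integrable_of_compactSpace {X : Type*} [TopologicalSpace X] [CompactSpace X]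
    [MeasurableSpace X] [BorelSpace X] (μ : Measure X) [IsFiniteMeasure μ] {u : X → ℝ}
    (hu : Continuous u) : Integrable u μ :=
  hu.integrable_of_hasCompactSupport (HasCompactSupport.of_compactSpace _)

/-! ### Duality on a compact space -/

/-- The values of the dual transport problem for the payoff `h`. -/
def dualValues {X : Type*} [TopologicalSpace X] [MeasurableSpace X] (μ ν : Measure X)
    (h : C(X × X, ℝ)) : Set ℝ :=
  {r | ∃ u v : C(X, ℝ), (∀ x y, h (x, y) ≤ u x + v y) ∧ ∫ x, u x ∂μ + ∫ y, v y ∂ν = r}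

theorem dualValues_nonempty {X : Type*} [TopologicalSpace X] [CompactSpace X] [MeasurableSpace X]
    {μ ν : Measure X} (h : C(X × X, ℝ)) : (dualValues μ ν h).Nonempty :=
  ⟨_, ContinuousMap.const X ‖h‖, 0, fun x y => by
    simpa using (le_abs_self _).trans (h.norm_coe_le_norm (x, y)), rfl⟩

section Duality

variable {X : Type*} [TopologicalSpace X] [CompactSpace X] [MeasurableSpace X] [BorelSpace X]
  {μ ν : Measure X} [IsFiniteMeasure μ] [IsFiniteMeasure ν]

/-- At a minimum point `a` of `u` the constraint forces `v ≥ -‖h‖ - u a`. After integration the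
terms in `u a` cancel because the masses agree, so the dual infimum is finite. -/
theorem neg_norm_mul_le_of_mem_dualValues (hmass : μ univ = ν univ) {h : C(X × X, ℝ)} {r : ℝ}
    (hr : r ∈ dualValues μ ν h) : -(‖h‖ * ν.real univ) ≤ r := by
  obtain ⟨u, v, huv, rfl⟩ := hr
  rcases isEmpty_or_nonempty X with hX | hX
  · simp [Measure.eq_zero_of_isEmpty]
  obtain ⟨a, ha⟩ := u.continuous.exists_forall_le_of_hasCompactSupport
    (HasCompactSupport.of_compactSpace _)
  have hu : ∫ _, u a ∂μ ≤ ∫ x, u x ∂μ :=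
    integral_mono (integrable_const _) (integrable_of_compactSpace μ u.continuous) ha
  have hv : ∫ _, (-‖h‖ - u a) ∂ν ≤ ∫ y, v y ∂ν :=
    integral_mono (integrable_const _) (integrable_of_compactSpace ν v.continuous) fun y => by
      have h₁ := huv a y
      have h₂ := (abs_le.mp (h.norm_coe_le_norm (a, y))).1
      change -‖h‖ - u a ≤ v y
      linarith
  have hm : μ.real univ = ν.real univ := by simp [Measure.real, hmass]
  simp only [integral_const, smul_eq_mul, hm] at hu hv
  linarith

theorem dualValues_bddBelow (hmass : μ univ = ν univ) (h : C(X × X, ℝ)) :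
    BddBelow (dualValues μ ν h) :=
  ⟨_, fun _ hr => neg_norm_mul_le_of_mem_dualValues hmass hr⟩

/-- The value function of the dual transport problem is sublinear in the payoff. -/
theorem sInf_dualValues_add_le (hmass : μ univ = ν univ) (h k : C(X × X, ℝ)) :
    sInf (dualValues μ ν (h + k)) ≤ sInf (dualValues μ ν h) + sInf (dualValues μ ν k) := by
  refine le_of_forall_pos_le_add fun ε hε => ?_
  obtain ⟨_, ⟨u, v, huv, rfl⟩, hr⟩ :=
    exists_lt_of_csInf_lt (dualValues_nonempty (μ := μ) (ν := ν) h)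
      (lt_add_of_pos_right _ (half_pos hε))
  obtain ⟨_, ⟨u', v', huv', rfl⟩, hr'⟩ :=
    exists_lt_of_csInf_lt (dualValues_nonempty (μ := μ) (ν := ν) k)
      (lt_add_of_pos_right _ (half_pos hε))
  have : sInf (dualValues μ ν (h + k)) ≤
      ∫ x, (u + u') x ∂μ + ∫ y, (v + v') y ∂ν :=
    csInf_le (dualValues_bddBelow hmass _) ⟨u + u', v + v', fun x y => by
      have h₁ := huv x y
      have h₂ := huv' x y
      simp only [ContinuousMap.add_apply]
      linarith, rfl⟩
  simp only [ContinuousMap.add_apply] at this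
  rw [integral_add (integrable_of_compactSpace μ u.continuous) (integrable_of_compactSpace μ u'.continuous),
    integral_add (integrable_of_compactSpace ν v.continuous) (integrable_of_compactSpace ν v'.continuous)] at this
  linarith

theorem sInf_dualValues_smul_le (hmass : μ univ = ν univ) {c : ℝ} (hc : 0 < c)
    (h : C(X × X, ℝ)) : sInf (dualValues μ ν (c • h)) ≤ c * sInf (dualValues μ ν h) := by
  rw [← div_le_iff₀' hc]
  refine le_csInf (dualValues_nonempty h) ?_
  rintro _ ⟨u, v, huv, rfl⟩
  rw [div_le_iff₀' hc]
  refine csInf_le (dualValues_bddBelow hmass _) ⟨c • u, c • v, fun x y => ?_, ?_⟩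
  · simpa [mul_add] using mul_le_mul_of_nonneg_left (huv x y) hc.le
  · simp [integral_const_mul, mul_add]

theorem sInf_dualValues_smul (hmass : μ univ = ν univ) (c : ℝ) (hc : 0 < c)
    (h : C(X × X, ℝ)) : sInf (dualValues μ ν (c • h)) = c * sInf (dualValues μ ν h) := by
  refine le_antisymm (sInf_dualValues_smul_le hmass hc h) ?_
  have := sInf_dualValues_smul_le (ν := ν) hmass (inv_pos.mpr hc) (c • h)
  rwa [inv_smul_smul₀ hc.ne', ← div_eq_inv_mul, le_div_iff₀' hc] at this

/-- Strong duality for the transport problem with continuous payoff `h` on a compact space: the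
maximum is attained by a transport plan. -/
theorem exists_plan_integral_eq_sInf_dualValues [T2Space X] [SecondCountableTopology X]
    [HasOuterApproxClosed X] (hmass : μ univ = ν univ) (h : C(X × X, ℝ)) :
    ∃ γ : Measure (X × X), IsFiniteMeasure γ ∧ γ.map Prod.fst = μ ∧ γ.map Prod.snd = ν ∧
      ∫ z, h z ∂γ = sInf (dualValues μ ν h) := by
  obtain ⟨Λ, hΛh, hΛ⟩ := exists_linearMap_le_sublinear_eq
    (fun k : C(X × X, ℝ) => sInf (dualValues μ ν k)) (sInf_dualValues_smul hmass)
    (sInf_dualValues_add_le hmass) h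
  have hle : ∀ (k : C(X × X, ℝ)) (u v : C(X, ℝ)), (∀ x y, k (x, y) ≤ u x + v y) →
      Λ k ≤ ∫ x, u x ∂μ + ∫ y, v y ∂ν := fun k u v huv =>
    (hΛ k).trans (csInf_le (dualValues_bddBelow hmass _) ⟨u, v, huv, rfl⟩)
  -- The pair `u = v = 0` is feasible for `-k` when `k ≥ 0`, so `Λ (-k) ≤ 0`.
  obtain ⟨γ, hγ, hγΛ⟩ := exists_isFiniteMeasure_integral_eq Λ fun k hk => by
    have := hle (-k) 0 0 fun x y => by simpa using hk (x, y)
    simpa using this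
  -- The pairs `(u, 0)` and `(-u, 0)` bound `Λ` from both sides; this fixes the first marginal.
  have hfst : ∀ u : C(X, ℝ), Λ (u.comp ContinuousMap.fst) = ∫ x, u x ∂μ := fun u => by
    refine le_antisymm (by simpa using hle _ u 0 fun x y => by simp) ?_
    have := hle (-u.comp ContinuousMap.fst) (-u) 0 fun x y => by simp
    simp only [map_neg, ContinuousMap.neg_apply, integral_neg, ContinuousMap.zero_apply,
      integral_zero] at this
    linarith
  have hsnd : ∀ v : C(X, ℝ), Λ (v.comp ContinuousMap.snd) = ∫ y, v y ∂ν := fun v => by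
    refine le_antisymm (by simpa using hle _ 0 v fun x y => by simp) ?_
    have := hle (-v.comp ContinuousMap.snd) 0 (-v) fun x y => by simp
    simp only [map_neg, ContinuousMap.neg_apply, integral_neg, ContinuousMap.zero_apply,
      integral_zero] at this
    linarith
  refine ⟨γ, hγ, ?_, ?_, (hγΛ h).trans hΛh⟩
  · refine ext_of_forall_integral_eq_of_IsFiniteMeasure fun u => ?_
    rw [integral_map measurable_fst.aemeasurable u.continuous.aestronglyMeasurable]
    exact (hγΛ (u.toContinuousMap.comp ContinuousMap.fst)).trans (hfst u.toContinuousMap)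
  · refine ext_of_forall_integral_eq_of_IsFiniteMeasure fun u => ?_
    rw [integral_map measurable_snd.aemeasurable u.continuous.aestronglyMeasurable]
    exact (hγΛ (u.toContinuousMap.comp ContinuousMap.snd)).trans (hsnd u.toContinuousMap)

end Duality

/-- If `-d ≤ u ⊕ v`, then a `1`-Lipschitz function separates `-u` from `v`. -/
theorem exists_lipschitzWith_of_neg_dist_le {X : Type*} [PseudoMetricSpace X] {u v : X → ℝ}
    (huv : ∀ x y, -dist x y ≤ u x + v y) :
    ∃ w : X → ℝ, LipschitzWith 1 w ∧ (∀ x, -u x ≤ w x) ∧ ∀ x, w x ≤ v x := by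
  have hb : ∀ x, BddBelow (range fun y => dist x y + v y) := fun x =>
    ⟨-u x, by rintro _ ⟨y, rfl⟩; have := huv x y; dsimp only; linarith⟩
  -- The inf-convolution of `v` with the distance: an infimum of `1`-Lipschitz functions, at most
  -- `v` by taking `y = x`, and at least `-u` by `huv`.
  refine ⟨fun x => ⨅ y, dist x y + v y, LipschitzWith.of_le_add fun x x' => ?_, fun x => ?_,
    fun x => (ciInf_le (hb x) x).trans (by simp)⟩
  · have : Nonempty X := ⟨x⟩
    rw [← sub_le_iff_le_add]
    refine le_ciInf fun y => ?_
    have h₁ := ciInf_le (hb x) y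
    have h₂ := dist_triangle x x' y
    linarith
  · have : Nonempty X := ⟨x⟩
    refine le_ciInf fun y => ?_
    have := huv x y
    linarith

/-- **Kantorovich–Rubinstein duality** on a compact metric space. -/
theorem exists_plan_integral_dist_le_of_lipschitz {X : Type*} [MetricSpace X] [CompactSpace X]
    [SecondCountableTopology X] [MeasurableSpace X] [BorelSpace X] {μ ν : Measure X} [IsFiniteMeasure μ] [IsFiniteMeasure ν]
    (hmass : μ univ = ν univ) :
    ∃ γ : Measure (X × X), IsFiniteMeasure γ ∧ γ.map Prod.fst = μ ∧ γ.map Prod.snd = ν ∧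
      ∀ ε > 0, ∃ w : X → ℝ, LipschitzWith 1 w ∧
        ∫ z, dist z.1 z.2 ∂γ ≤ ∫ x, w x ∂μ - ∫ x, w x ∂ν + ε := by
  let d : C(X × X, ℝ) := ⟨fun z => dist z.1 z.2, by fun_prop⟩
  -- The payoff `-d` turns maximal payoff into minimal cost; `γ` is chosen before `ε`.
  obtain ⟨γ, hγ, hμ, hν, hd⟩ := exists_plan_integral_eq_sInf_dualValues hmass (-d)
  refine ⟨γ, hγ, hμ, hν, fun ε hε => ?_⟩
  obtain ⟨_, ⟨u, v, huv, rfl⟩, hr⟩ :=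
    exists_lt_of_csInf_lt (dualValues_nonempty (μ := μ) (ν := ν) (-d))
      (lt_add_of_pos_right _ hε)
  obtain ⟨w, hw, huw, hwv⟩ := exists_lipschitzWith_of_neg_dist_le huv
  have hi : ∀ (ρ : Measure X) [IsFiniteMeasure ρ], Integrable w ρ := fun ρ _ =>
    integrable_of_compactSpace ρ hw.continuous
  have h₁ := integral_mono (integrable_of_compactSpace μ u.continuous).neg (hi μ) huw
  have h₂ := integral_mono (hi ν) (integrable_of_compactSpace ν v.continuous) hwv
  have h₃ : ∫ z, (-d) z ∂γ = -∫ z, dist z.1 z.2 ∂γ := integral_neg _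
  simp only [Pi.neg_apply, integral_neg] at h₁
  refine ⟨w, hw, ?_⟩
  linarith

/-! ### Approximation of Lipschitz functions in `C^1_0` -/

theorem IsC10.of_hasCompactSupport {N : ℕ} {φ : E N → ℝ} (hφ : ContDiff ℝ 1 φ)
    (hc : HasCompactSupport φ) : IsC10 φ :=
  ⟨hφ, hc.is_zero_at_infty, (hc.fderiv ℝ).is_zero_at_infty⟩

open scoped Convolution in
/-- A compactly supported `K`-Lipschitz function is a uniform limit of smooth compactly supported
`K`-Lipschitz functions. -/
theorem exists_contDiff_lipschitzWith_dist_le {N : ℕ} {K : ℝ≥0} {g : E N → ℝ}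
    (hg : LipschitzWith K g) (hc : HasCompactSupport g) {ε : ℝ} (hε : 0 < ε) :
    ∃ u : E N → ℝ, ContDiff ℝ 1 u ∧ HasCompactSupport u ∧ LipschitzWith K u ∧
      ∀ x, dist (u x) (g x) ≤ K * ε := by
  let b : ContDiffBump (0 : E N) := ⟨ε / 2, ε, half_pos hε, half_lt_self hε⟩
  let u : E N → ℝ := b.normed volume ⋆[ContinuousLinearMap.lsmul ℝ ℝ, volume] g
  have hbc : Continuous (b.normed volume) := b.continuous_normed
  have hi : ∀ x, Integrable (fun t => b.normed volume t * g (x - t)) := fun x =>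
    (hbc.mul (hg.continuous.comp (by fun_prop))).integrable_of_hasCompactSupport
      b.hasCompactSupport_normed.mul_right
  refine ⟨u, ?_, ?_, ?_, fun x => ?_⟩
  · exact b.hasCompactSupport_normed.contDiff_convolution_left _ b.contDiff_normed
      hg.continuous.locallyIntegrable
  · exact b.hasCompactSupport_normed.convolution _ hc
  · refine LipschitzWith.of_dist_le_mul fun x y => ?_
    rw [dist_eq_norm]
    change ‖(∫ t, b.normed volume t * g (x - t)) - ∫ t, b.normed volume t * g (y - t)‖ ≤ _
    rw [← integral_sub (hi x) (hi y)]
    -- Averaging translates of `g` against a kernel of mass one preserves the Lipschitz constant.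
    calc _ ≤ ∫ t, b.normed volume t * (K * dist x y) := by
          refine norm_integral_le_of_norm_le (b.integrable_normed.mul_const _)
            (Eventually.of_forall fun t => ?_)
          rw [← mul_sub, norm_mul, Real.norm_of_nonneg (b.nonneg_normed t), ← dist_eq_norm]
          refine mul_le_mul_of_nonneg_left ?_ (b.nonneg_normed t)
          simpa using hg.dist_le_mul (x - t) (y - t)
      _ = K * dist x y := by rw [integral_mul_const, b.integral_normed, one_mul]
  · refine b.dist_normed_convolution_le hg.continuous.aestronglyMeasurable fun y hy => ?_
    exact (hg.dist_le_mul y x).trans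
      (mul_le_mul_of_nonneg_left (Metric.mem_ball.mp hy).le K.2)

/-- A `1`-Lipschitz function on a bounded set extends to a compactly supported `1`-Lipschitz
function. -/
theorem exists_lipschitzWith_hasCompactSupport_eqOn {N : ℕ} {Ω : Set (E N)}
    (hΩ : Bornology.IsBounded Ω) {w : E N → ℝ} (hw : LipschitzOnWith 1 w Ω) :
    ∃ g : E N → ℝ, LipschitzWith 1 g ∧ HasCompactSupport g ∧ EqOn w g Ω := by
  obtain ⟨w', hw', heq⟩ := hw.extend_real
  obtain ⟨r, hr⟩ := hΩ.exists_norm_le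
  -- On `Ω`, `|w' x| ≤ |w' 0| + ‖x‖ ≤ R - ‖x‖`. Hence clamping `w'` between `-k` and `k` leaves it
  -- unchanged there, while `k` vanishes for `‖x‖ ≥ R`.
  let R : ℝ := 2 * r + |w' 0|
  let k : E N → ℝ := fun x => max (R - ‖x‖) 0
  have hk : LipschitzWith 1 k := by
    refine LipschitzWith.max_const (LipschitzWith.of_le_add fun x y => ?_) 0
    have := norm_sub_norm_le y x
    rw [dist_comm, dist_eq_norm]
    linarith
  have hk0 : ∀ x, 0 ≤ k x := fun x => le_max_right _ _
  have hknorm : ∀ x, R ≤ ‖x‖ → k x = 0 := fun x hx => max_eq_right (by linarith)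
  have hkneg : LipschitzWith 1 fun x => -k x := hk.neg
  have hmax : LipschitzWith 1 fun x => max (-k x) (min (w' x) (k x)) := by
    have := hkneg.max (hw'.min hk)
    rwa [max_self, max_self] at this
  refine ⟨_, hmax, ?_, fun x hx => ?_⟩
  · refine HasCompactSupport.intro (isCompact_closedBall (0 : E N) R) fun x hx => ?_
    have hx' : R ≤ ‖x‖ := by
      simp only [Metric.mem_closedBall, dist_zero_right, not_le] at hx
      exact hx.le
    simp only [hknorm x hx', neg_zero]
    exact max_eq_left (min_le_right _ _)
  · have h₁ := hw'.dist_le_mul x 0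
    simp only [NNReal.coe_one, one_mul, dist_zero_right, Real.dist_eq] at h₁
    have h₂ := abs_sub_abs_le_abs_sub (w' x) (w' 0)
    have h₃ := hr x hx
    have h₄ : |w' x| ≤ k x := le_max_of_le_left (by simp only [R]; linarith)
    have h₅ := abs_le.mp h₄
    simp only
    rw [heq hx, min_eq_left h₅.2, max_eq_right h₅.1]

theorem exists_isC10_dist_le {N : ℕ} {Ω : Set (E N)} (hΩ : Bornology.IsBounded Ω) {w : Ω → ℝ}
    (hw : LipschitzWith 1 w) {ε : ℝ} (hε : 0 < ε) :
    ∃ u : E N → ℝ, IsC10 u ∧ (∀ x, ‖fderiv ℝ u x‖ ≤ 1) ∧ ∀ x : Ω, |u x - w x| ≤ ε := by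
  let W : E N → ℝ := Function.extend Subtype.val w 0
  have hW : ∀ x : Ω, W x = w x := fun x => Subtype.val_injective.extend_apply w 0 x
  have hWlip : LipschitzOnWith 1 W Ω := by
    rw [lipschitzOnWith_iff_restrict]
    convert hw using 1
    exact funext hW
  obtain ⟨g, hg, hgc, hgW⟩ := exists_lipschitzWith_hasCompactSupport_eqOn hΩ hWlip
  obtain ⟨u, hu, huc, hul, hug⟩ := exists_contDiff_lipschitzWith_dist_le hg hgc hε
  refine ⟨u, .of_hasCompactSupport hu huc, fun x => by
    simpa using norm_fderiv_le_of_lipschitz ℝ hul (x₀ := x), fun x => ?_⟩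
  rw [← hW x, hgW x.2, ← Real.dist_eq]
  simpa using hug x

/-! ### The lift of a plan and its difference quotients -/

variable {N : ℕ} {Ω : Set (E N)}

theorem measurable_pMap (e₁ : S N) : Measurable (pMap (Ω := Ω) e₁) := by
  classical
  have h₁ : ∀ z : Ω × Ω, (pMap e₁ z).1 = z.2 := fun z => by
    unfold pMap
    split_ifs with h
    · exact Subtype.ext h
    · rfl
  have h₂ : ∀ z : Ω × Ω, ((pMap e₁ z).2.1 : E N) = if (z.1 : E N) = z.2 then (e₁ : E N)
      else ‖(z.1 : E N) - z.2‖⁻¹ • ((z.1 : E N) - z.2) := fun z => by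
    unfold pMap
    split_ifs with h
    · rfl
    · rfl
  have h₃ : ∀ z : Ω × Ω, (pMap e₁ z).2.2 = nndist z.1 z.2 := fun z => by
    unfold pMap
    split_ifs with h
    · simp [Subtype.ext h]
    · rfl
  refine Measurable.prodMk (f := fun z => (pMap e₁ z).1) (g := fun z => (pMap e₁ z).2) ?_
    (Measurable.prodMk (f := fun z => (pMap e₁ z).2.1) (g := fun z => (pMap e₁ z).2.2) ?_ ?_)
  · simp only [h₁]
    exact measurable_snd
  · refine (MeasurableEmbedding.subtype_coe
      Metric.isClosed_sphere.measurableSet).measurable_comp_iff.mp ?_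
    change Measurable fun z => ((pMap e₁ z).2.1 : E N)
    simp only [h₂]
    refine Measurable.ite ?_ measurable_const ?_
    · exact measurableSet_eq_fun (by fun_prop) (by fun_prop)
    · fun_prop
  · simp only [h₃]
    exact measurable_nndist

theorem measurable_diffQuot {φ : E N → ℝ} (hφ : ContDiff ℝ 1 φ) :
    Measurable (diffQuot (Ω := Ω) φ) := by
  have h₀ : Continuous φ := hφ.continuous
  have h₁ : Continuous fun q : Phase Ω => fderiv ℝ φ (q.1 : E N) (q.2.1 : E N) :=
    ((hφ.continuous_fderiv one_ne_zero).comp (by fun_prop)).clm_apply (by fun_prop)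
  have h₂ : Continuous fun q : Phase Ω =>
      φ ((q.1 : E N) + (q.2.2 : ℝ) • (q.2.1 : E N)) - φ (q.1 : E N) := by fun_prop
  have h₃ : Continuous fun q : Phase Ω => (q.2.2 : ℝ) := by fun_prop
  exact Measurable.ite (measurableSet_eq_fun (by fun_prop) measurable_const) h₁.measurable
    (h₂.measurable.div h₃.measurable)

/-- Off the diagonal, `y + |x - y| v = x` for the direction `v`, and the weight cancels the
denominator. On the diagonal both sides vanish, so the choice of `e₁` is immaterial. -/
theorem dist_mul_diffQuot_pMap (φ : E N → ℝ) (e₁ : S N) (z : Ω × Ω) :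
    dist z.1 z.2 * diffQuot φ (pMap e₁ z) = φ z.1 - φ z.2 := by
  unfold pMap
  split_ifs with h
  · simp [Subtype.ext h]
  · have hd : ‖(z.1 : E N) - z.2‖ ≠ 0 := norm_ne_zero_iff.mpr (sub_ne_zero.mpr h)
    have hd' : (nndist z.1 z.2 : ℝ) = ‖(z.1 : E N) - z.2‖ := by
      rw [coe_nndist, Subtype.dist_eq, dist_eq_norm]
    have hn : nndist z.1 z.2 ≠ 0 := fun h₀ => hd (by rw [← hd', h₀, NNReal.coe_zero])
    have hs : (z.2 : E N) + ‖(z.1 : E N) - z.2‖ • (‖(z.1 : E N) - z.2‖⁻¹ • ((z.1 : E N) - z.2)) =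
        z.1 := by rw [smul_inv_smul₀ hd, add_sub_cancel]
    simp only [diffQuot, if_neg hn, direction, hd', Subtype.dist_eq, dist_eq_norm, hs]
    exact mul_div_cancel₀ _ hd

/-- The operator norm on a unit vector settles `t = 0`; the mean value inequality settles `t > 0`.
-/
theorem abs_diffQuot_le_one {u : E N → ℝ} (hu : ContDiff ℝ 1 u) (h : ∀ x, ‖fderiv ℝ u x‖ ≤ 1)
    (q : Phase Ω) : |diffQuot u q| ≤ 1 := by
  have hv : ‖(q.2.1 : E N)‖ = 1 := mem_sphere_zero_iff_norm.mp q.2.1.2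
  unfold diffQuot
  split_ifs with ht
  · simpa [hv] using (fderiv ℝ u (q.1 : E N)).le_of_opNorm_le (h _) (q.2.1 : E N)
  · have ht' : 0 < (q.2.2 : ℝ) := NNReal.coe_pos.mpr (pos_iff_ne_zero.mpr ht)
    have := convex_univ.norm_image_sub_le_of_norm_fderiv_le (𝕜 := ℝ)
      (fun x _ => (hu.differentiable one_ne_zero) x) (fun x _ => h x)
      (mem_univ (q.1 : E N)) (mem_univ ((q.1 : E N) + (q.2.2 : ℝ) • (q.2.1 : E N)))
    rw [abs_div, abs_of_pos ht', div_le_one ht', ← Real.norm_eq_abs]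
    simpa [norm_smul, hv] using this

theorem liftPlan_univ (e₁ : S N) (γ : Measure (Ω × Ω)) : liftPlan e₁ γ univ = cost γ := by
  rw [liftPlan, Measure.map_apply (measurable_pMap e₁) MeasurableSet.univ, preimage_univ,
    withDensity_apply _ MeasurableSet.univ, Measure.restrict_univ, cost]

theorem integral_liftPlan (e₁ : S N) (γ : Measure (Ω × Ω)) {φ : E N → ℝ}
    (hφ : ContDiff ℝ 1 φ) :
    ∫ q, diffQuot φ q ∂(liftPlan e₁ γ) = ∫ z : Ω × Ω, (φ z.1 - φ z.2) ∂γ := by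
  rw [liftPlan, integral_map (measurable_pMap e₁).aemeasurable
      (measurable_diffQuot hφ).aestronglyMeasurable,
    integral_withDensity_eq_integral_toReal_smul measurable_edist
      (Eventually.of_forall fun z => edist_lt_top _ _)]
  refine integral_congr_ae (Eventually.of_forall fun z => ?_)
  simp only [smul_eq_mul, ← dist_edist, dist_mul_diffQuot_pMap]

section Compact

variable [CompactSpace Ω]

theorem integrable_coe_of_continuous (μ : Measure Ω) [IsFiniteMeasure μ] {φ : E N → ℝ}
    (hφ : Continuous φ) : Integrable (fun x : Ω => φ x) μ :=
  integrable_of_compactSpace μ (hφ.comp continuous_subtype_val)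

theorem pairing_sub_eq (μ ν : Measure Ω) [IsFiniteMeasure μ] [IsFiniteMeasure ν] {φ : E N → ℝ}
    (hφ : Continuous φ) : pairing (μ.toSignedMeasure - ν.toSignedMeasure) φ =
      ∫ x : Ω, φ x ∂μ - ∫ x : Ω, φ x ∂ν := by
  have hi : ∀ (ρ : Measure Ω) [IsFiniteMeasure ρ],
      ρ.toSignedMeasure.Integrable (fun x : Ω => φ x) := fun ρ _ => by
    rw [VectorMeasure.Integrable, Measure.variation_toSignedMeasure]
    exact integrable_coe_of_continuous ρ hφ
  rw [pairing, VectorMeasure.integral_sub_vectorMeasure (hi μ) (hi ν),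
    VectorMeasure.integral_toSignedMeasure, VectorMeasure.integral_toSignedMeasure]

theorem ofReal_integral_dist_eq_cost (γ : Measure (Ω × Ω)) [IsFiniteMeasure γ] :
    ENNReal.ofReal (∫ z, dist z.1 z.2 ∂γ) = cost γ := by
  rw [ofReal_integral_eq_lintegral_ofReal
    (integrable_of_compactSpace γ (by fun_prop))
    (Eventually.of_forall fun z => dist_nonneg)]
  simp only [cost, edist_dist]

/-- Only the difference of the marginals enters `∫ (φ(x) - φ(y)) dγ`, so this serves transport plans
and competitors of `kantorovichNorm` alike. -/
theorem isAdmissible_liftPlan (e₁ : S N) {f : SignedMeasure Ω} (γ : Measure (Ω × Ω))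
    [IsFiniteMeasure γ]
    (hγ : (γ.map Prod.fst).toSignedMeasure - (γ.map Prod.snd).toSignedMeasure = f) :
    IsAdmissible f (liftPlan e₁ γ) := by
  refine ⟨⟨?_⟩, fun φ hφ => ?_⟩
  · rw [liftPlan_univ, ← ofReal_integral_dist_eq_cost]
    exact ENNReal.ofReal_lt_top
  · have hc := hφ.contDiff.continuous
    have hm : ∀ (ρ : Measure Ω), AEStronglyMeasurable (fun x : Ω => φ x) ρ := fun ρ =>
      (hc.comp continuous_subtype_val).aestronglyMeasurable
    have h₁ : Integrable (fun z : Ω × Ω => φ z.1) γ :=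
      integrable_of_compactSpace γ (by fun_prop)
    have h₂ : Integrable (fun z : Ω × Ω => φ z.2) γ :=
      integrable_of_compactSpace γ (by fun_prop)
    rw [integral_liftPlan e₁ γ hφ.contDiff, ← hγ, pairing_sub_eq _ _ hc, integral_sub h₁ h₂,
      integral_map measurable_fst.aemeasurable (hm _),
      integral_map measurable_snd.aemeasurable (hm _)]

end Compact

/-! ### Comparison of the values -/

theorem wassersteinNorm_le_of_isAdmissible {f : SignedMeasure Ω} {σ : Measure (Phase Ω)}
    (hσ : IsAdmissible f σ) : wassersteinNorm f ≤ σ univ := by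
  have := hσ.finite
  refine iSup_le fun u => iSup_le fun hu => iSup_le fun hu' => ?_
  rw [← hσ.integral_eq u hu]
  refine ENNReal.ofReal_le_of_le_toReal ((le_abs_self _).trans ?_)
  simpa [Measure.real] using norm_integral_le_of_norm_le_const (μ := σ) (f := diffQuot u)
    (C := 1) (Eventually.of_forall fun q => abs_diffQuot_le_one hu.contDiff hu' q)

theorem IsTransportPlan.isFiniteMeasure {fp fm : Measure Ω} [IsFiniteMeasure fp]
    {γ : Measure (Ω × Ω)} (hγ : IsTransportPlan fp fm γ) : IsFiniteMeasure γ := by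
  have : IsFiniteMeasure (γ.map Prod.fst) := hγ.map_fst ▸ inferInstance
  exact Measure.isFiniteMeasure_of_map measurable_fst.aemeasurable

theorem IsTransportPlan.sub_map_eq {fp fm : Measure Ω} [IsFiniteMeasure fp] [IsFiniteMeasure fm]
    {γ : Measure (Ω × Ω)} [IsFiniteMeasure γ] (hγ : IsTransportPlan fp fm γ) :
    (γ.map Prod.fst).toSignedMeasure - (γ.map Prod.snd).toSignedMeasure =
      fp.toSignedMeasure - fm.toSignedMeasure := by
  simp only [hγ.map_fst, hγ.map_snd]

theorem exists_isTransportPlan_cost_le_wassersteinNorm [CompactSpace Ω] {fp fm : Measure Ω}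
    [IsFiniteMeasure fp] [IsFiniteMeasure fm] (hmass : fp univ = fm univ) :
    ∃ γ : Measure (Ω × Ω), IsTransportPlan fp fm γ ∧
      cost γ ≤ wassersteinNorm (fp.toSignedMeasure - fm.toSignedMeasure) := by
  obtain ⟨γ, hγ, h₁, h₂, hw⟩ := exists_plan_integral_dist_le_of_lipschitz hmass
  refine ⟨γ, ⟨h₁, h₂⟩, ENNReal.le_of_forall_pos_le_add fun ε hε _ => ?_⟩
  -- With `δ = ε / M`, the errors are `δ` from the duality gap and `δ` times each mass from
  -- replacing `w` by `u`; they add up to `δ * M = ε`.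
  let M : ℝ := 1 + fp.real univ + fm.real univ
  have hM : 0 < M := by positivity
  have hδ : 0 < (ε : ℝ) / M := div_pos hε hM
  obtain ⟨w, hwlip, hle⟩ := hw _ hδ
  obtain ⟨u, hu, hu', huw⟩ := exists_isC10_dist_le
    (isCompact_iff_compactSpace.mpr ‹_›).isBounded hwlip hδ
  have hclose : ∀ (ρ : Measure Ω) [IsFiniteMeasure ρ],
      |∫ x : Ω, u x ∂ρ - ∫ x, w x ∂ρ| ≤ ε / M * ρ.real univ := fun ρ _ => by
    rw [← integral_sub (integrable_coe_of_continuous ρ hu.contDiff.continuous)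
      (integrable_of_compactSpace ρ hwlip.continuous)]
    exact norm_integral_le_of_norm_le_const (f := fun x : Ω => u x - w x) (C := ε / M)
      (Eventually.of_forall huw)
  have hp := abs_le.mp (hclose fp)
  have hm := abs_le.mp (hclose fm)
  have hsum : ε / M + ε / M * fp.real univ + ε / M * fm.real univ = ε := by
    rw [← mul_one_add, ← mul_add]
    exact div_mul_cancel₀ _ hM.ne'
  have hfin : ∫ z, dist z.1 z.2 ∂γ ≤ pairing (fp.toSignedMeasure - fm.toSignedMeasure) u + ε := by
    rw [pairing_sub_eq _ _ hu.contDiff.continuous]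
    linarith
  calc cost γ = ENNReal.ofReal (∫ z, dist z.1 z.2 ∂γ) := (ofReal_integral_dist_eq_cost γ).symm
    _ ≤ ENNReal.ofReal (pairing (fp.toSignedMeasure - fm.toSignedMeasure) u) +
        ENNReal.ofReal ε := (ENNReal.ofReal_le_ofReal hfin).trans ENNReal.ofReal_add_le
    _ ≤ _ := by
      rw [ENNReal.ofReal_coe_nnreal]
      gcongr
      exact le_iSup_of_le u (le_iSup_of_le hu (le_iSup_of_le hu' le_rfl))

end TransportComparison

theorem mainTheorem5 {N : ℕ} (Ω : Set (TransportComparison.E N))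
    (hΩ : IsCompact Ω) (hconv : Convex ℝ Ω)
    (e₁ : TransportComparison.S N)
    (fp fm : Measure Ω) [IsFiniteMeasure fp] [IsFiniteMeasure fm]
    (hmass : fp univ = fm univ)
    (f : SignedMeasure Ω) (hf : f = fp.toSignedMeasure - fm.toSignedMeasure) :
    (∀ γ : Measure (Ω × Ω), TransportComparison.IsTransportPlan fp fm γ →
      TransportComparison.IsAdmissible f (TransportComparison.liftPlan e₁ γ)) ∧
    (∀ γ : Measure (Ω × Ω), TransportComparison.IsOptimalPlan fp fm γ →
      TransportComparison.IsOptimal f (TransportComparison.liftPlan e₁ γ)) ∧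
    (∃ σ : Measure (TransportComparison.Phase Ω), TransportComparison.IsOptimal f σ) ∧
    TransportComparison.wassersteinNorm f = TransportComparison.dualMinValue f ∧
    TransportComparison.kantorovichNorm f = TransportComparison.dualMinValue f ∧
    TransportComparison.wassersteinDist fp fm = TransportComparison.dualMinValue f := by
  open TransportComparison in
  have : CompactSpace Ω := isCompact_iff_compactSpace.mp hΩ
  obtain ⟨γ₀, hγ₀, hcost⟩ := exists_isTransportPlan_cost_le_wassersteinNorm hmass
  rw [← hf] at hcost
  have hadm : ∀ γ : Measure (Ω × Ω), IsTransportPlan fp fm γ → IsAdmissible f (liftPlan e₁ γ) :=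
    fun γ hγ => by
      have := hγ.isFiniteMeasure
      exact isAdmissible_liftPlan e₁ γ (hγ.sub_map_eq.trans hf.symm)
  have hopt : ∀ γ : Measure (Ω × Ω), IsOptimalPlan fp fm γ → IsOptimal f (liftPlan e₁ γ) :=
    fun γ hγ => ⟨hadm γ hγ.plan, fun σ hσ => by
      rw [liftPlan_univ]
      exact (hγ.le γ₀ hγ₀).trans (hcost.trans (wassersteinNorm_le_of_isAdmissible hσ))⟩
  have h₁ : wassersteinNorm f ≤ dualMinValue f :=
    le_iInf₂ fun σ hσ => wassersteinNorm_le_of_isAdmissible hσ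
  have h₂ : dualMinValue f ≤ kantorovichNorm f :=
    le_iInf fun γ => le_iInf fun _ => le_iInf fun hγ =>
      (iInf₂_le _ (isAdmissible_liftPlan e₁ γ hγ)).trans_eq (liftPlan_univ e₁ γ)
  have h₃ : kantorovichNorm f ≤ wassersteinDist fp fm :=
    le_iInf₂ fun γ hγ => by
      have := hγ.isFiniteMeasure
      exact iInf_le_of_le γ (iInf_le_of_le this
        (iInf_le_of_le (hγ.sub_map_eq.trans hf.symm) le_rfl))
  have h₄ : wassersteinDist fp fm ≤ wassersteinNorm f := (iInf₂_le γ₀ hγ₀).trans hcost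
  -- The cost of `γ₀` is at most `wassersteinNorm f`, which bounds the cost of every plan from
  -- below.
  have hγ₀opt : IsOptimalPlan fp fm γ₀ :=
    ⟨hγ₀, fun γ hγ => (hcost.trans (h₁.trans (h₂.trans h₃))).trans (iInf₂_le γ hγ)⟩
  exact ⟨hadm, hopt, ⟨_, hopt γ₀ hγ₀opt⟩, h₁.antisymm (h₂.trans (h₃.trans h₄)),
    (h₃.trans (h₄.trans h₁)).antisymm h₂, (h₄.trans h₁).antisymm (h₂.trans h₃)⟩
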